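/- Let $n,r,d,m\in\mathbb N_0$ with $m\ge d$, and put $\mathbb N^n_d=\{\alpha\in\mathbb N_0^n:|\alpha|\le d\}$, where $|\alpha|=\sum_i\alpha_i$. Let $T_k$ be the Chebyshev polynomials of the first kind, $\hat T_0=T_0$, $\hat T_k=\sqrt2\,T_k$ for $k\ge1$, and $T_\alpha(\mathbf x)=\prod_i T_{\alpha_i}(x_i)$, $\hat T_\alpha(\mathbf x)=\prod_i\hat T_{\alpha_i}(x_i)$; let $\omega(\alpha)$ be the number of nonzero entries of $\alpha$ and $\mathrm d\mu(\mathbf x)=\prod_{i=1}^n\frac{\mathrm dx_i}{\pi\sqrt{1-x_i^2}}$ on $[-1,1]^n$. Let $\mathcal T_r=\mathcal T(1\pm x_1,\dots,1\pm x_n)_r$ be the truncated pre-ordering, i.e. the set of all polynomials $\sum_{I}\sigma_I\prod_{i\in I}g_i$, where $g_1,\dots,g_{2n}$ are the polynomials $1-x_i$, $1+x_i$, $I$ runs over all subsets of $\{1,\dots,2n\}$, every $\sigma_I$ is a sum of squares of real polynomials, and $\deg\bigl(\sigma_I\prod_{i\in I}g_i\bigr)\le r$ for every $I$. Let $\Theta^r_{n,d}$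 be the infimum of $\max_{|\alpha|\le d}|1-\lambda_\alpha|$ over all families of coefficients $\lambda_\alpha\in[0,1]$ with $\lambda_{\mathbf 0}=1$ and $\lambda_\alpha=0$ for $|\alpha|>r$ such that the kernel $K_r(\mathbf x,\mathbf y)=1+\sum_{\alpha\in\mathbb N^n_r\setminus\{\mathbf 0\}}\lambda_\alpha\hat T_\alpha(\mathbf x)\hat T_\alpha(\mathbf y)$ satisfies: for every polynomial $f$ of degree at most $d$ that is nonnegative on $[-1,1]^n$, the function $\mathbf x\mapsto\int_{[-1,1]^n}f(\mathbf y)K_r(\mathbf x,\mathbf y)\,\mathrm d\mu(\mathbf y)$ is a polynomial in $\mathcal T_r$. Then $$\Theta^r_{n,d}\le\inf\Bigl\{\max_{|\alpha|\le d}|1-p_\alpha| \;:\; p_{\mathbf 0}=1,\ 1+\sum_{\alpha\in\mathbb N^n_m\setminus\{\mathbf 0\}}2^{\omega(\alpha)}p_\alpha T_\alpha(\mathbf x)\in\mathcal T_r\Bigr\}.$$ Moreover, the infimum on the right is the optimal value of a semidefinite program: it equals the infimum of all $t\in\mathbb R$ for which there are real numbers $p_\alpha$ with $p_{\mathbf 0}=1$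 and $-t\le1-p_\alpha\le t$ for $|\alpha|\le d$, and, for every $I\subseteq\{1,\dots,2n\}$, a real positive semidefinite matrix $Q_I$ indexed by the $\beta\in\mathbb N_0^n$ with $2|\beta|+|I|\le r$, such that $$1+\sum_{\alpha\in\mathbb N^n_m\setminus\{\mathbf 0\}}2^{\omega(\alpha)}p_\alpha T_\alpha(\mathbf x)=\sum_I\Bigl(\sum_{\beta,\gamma}(Q_I)_{\beta\gamma}\,\mathbf x^{\beta+\gamma}\Bigr)\prod_{i\in I}g_i(\mathbf x)$$ as polynomials in $\mathbf x$. -/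

import Mathlib

open MeasureTheory

noncomputable section

namespace ChebKernel

/-- The multi-indices `α ∈ ℕ₀ⁿ` with `|α| = α₁ + ⋯ + αₙ ≤ d`. -/
def multiIndex (n d : ℕ) : Finset (Fin n → ℕ) :=
  (Fintype.piFinset fun _ => Finset.range (d + 1)).filter fun α => ∑ i, α i ≤ d

theorem mem_multiIndex {n d : ℕ} {α : Fin n → ℕ} : α ∈ multiIndex n d ↔ ∑ i, α i ≤ d := by
  simp only [multiIndex, Finset.mem_filter, Fintype.mem_piFinset, Finset.mem_range,
    and_iff_right_iff_imp]
  intro h i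
  have := Finset.single_le_sum (f := α) (fun j _ => Nat.zero_le _) (Finset.mem_univ i)
  omega

theorem zero_mem_multiIndex (n d : ℕ) : (0 : Fin n → ℕ) ∈ multiIndex n d := by
  simp [mem_multiIndex]

theorem multiIndex_nonempty (n d : ℕ) : (multiIndex n d).Nonempty := ⟨0, zero_mem_multiIndex n d⟩

/-! ### Chebyshev polynomials in several variables -/

/-- The multivariate Chebyshev polynomial `T_α(x) = ∏ᵢ T_{αᵢ}(xᵢ)`. -/
def chebT {n : ℕ} (α : Fin n → ℕ) : MvPolynomial (Fin n) ℝ :=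
  ∏ i, Polynomial.aeval (MvPolynomial.X i) (Polynomial.Chebyshev.T ℝ (α i : ℤ))

/-- The univariate normalized Chebyshev polynomial: `T̂₀ = T₀` and `T̂ₖ = √2 Tₖ` for `k ≥ 1`. -/
def chebHat1 (k : ℕ) : Polynomial ℝ :=
  if k = 0 then Polynomial.Chebyshev.T ℝ 0
  else Polynomial.C (Real.sqrt 2) * Polynomial.Chebyshev.T ℝ (k : ℤ)

/-- The multivariate normalized Chebyshev polynomial, as a function:
`T̂_α(x) = ∏ᵢ T̂_{αᵢ}(xᵢ)`. -/
def chebHat {n : ℕ} (α : Fin n → ℕ) (x : Fin n → ℝ) : ℝ := ∏ i, (chebHat1 (α i)).eval (x i)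

/-- The number `ω(α)` of nonzero entries of `α`. -/
def omega {n : ℕ} (α : Fin n → ℕ) : ℕ := (Finset.univ.filter fun i => α i ≠ 0).card

/-- The Chebyshev product measure `∏ᵢ dxᵢ / (π √(1 - xᵢ²))` on `[-1,1]ⁿ`; here
`Polynomial.Chebyshev.measureT` is Lebesgue measure on `(-1, 1]` with density `(1 - x²)^(-1/2)`. -/
def chebMeasure (n : ℕ) : Measure (Fin n → ℝ) :=
  Measure.pi fun _ => (ENNReal.ofReal Real.pi)⁻¹ • Polynomial.Chebyshev.measureT

/-! ### Truncated pre-orderings -/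

/-- The truncated pre-ordering `𝒯(gᵢ : i ∈ ι)_r`: all sums `∑_{I ⊆ ι} σ_I ∏_{i ∈ I} gᵢ` with sums
of squares `σ_I` and every term of degree at most `r`. -/
def truncPreordering {n : ℕ} {ι : Type*} [Fintype ι] (g : ι → MvPolynomial (Fin n) ℝ) (r : ℕ) :
    Set (MvPolynomial (Fin n) ℝ) :=
  {p | ∃ σ : Finset ι → MvPolynomial (Fin n) ℝ,
    (∀ I, IsSumSq (σ I)) ∧ (∀ I, (σ I * ∏ i ∈ I, g i).totalDegree ≤ r) ∧
    p = ∑ I : Finset ι, σ I * ∏ i ∈ I, g i}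

/-- The `2n` polynomials `1 - xᵢ` and `1 + xᵢ` describing the cube `[-1,1]ⁿ`. -/
def cubeGen (n : ℕ) : Fin n ⊕ Fin n → MvPolynomial (Fin n) ℝ :=
  Sum.elim (fun i => 1 - MvPolynomial.X i) (fun i => 1 + MvPolynomial.X i)

/-- `𝒯(1 ± x₁, …, 1 ± xₙ)_r`. -/
def cubePreordering (n r : ℕ) : Set (MvPolynomial (Fin n) ℝ) := truncPreordering (cubeGen n) r

/-! ### The quantity `Θ` -/

/-- The kernel `K_r(x,y) = 1 + ∑_{0 < |α| ≤ r} lam_α T̂_α(x) T̂_α(y)`. -/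
def kernel (n r : ℕ) (lam : (Fin n → ℕ) → ℝ) (x y : Fin n → ℝ) : ℝ :=
  1 + ∑ α ∈ (multiIndex n r).erase 0, lam α * chebHat α x * chebHat α y

/-- The convolution `f ↦ ∫ f(y) K(x,y) dμ(y)` maps every polynomial `f` of degree at most `d` that
is nonnegative on `[-1,1]ⁿ` into `𝒯(1 ± x₁, …, 1 ± xₙ)_r`. -/
def KernelCondition (n r d : ℕ) (K : (Fin n → ℝ) → (Fin n → ℝ) → ℝ) : Prop :=
  ∀ f : MvPolynomial (Fin n) ℝ, f.totalDegree ≤ d →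
    (∀ x ∈ Set.Icc (-1 : Fin n → ℝ) 1, 0 ≤ MvPolynomial.eval x f) →
    ∃ q ∈ cubePreordering n r, ∀ x : Fin n → ℝ,
      MvPolynomial.eval x q = ∫ y, MvPolynomial.eval y f * K x y ∂(chebMeasure n)

/-- `max_{|α| ≤ d} |1 - c_α|`. -/
def maxDev (n d : ℕ) (c : (Fin n → ℕ) → ℝ) : ℝ :=
  (multiIndex n d).sup' (multiIndex_nonempty n d) fun α => |1 - c α|

/-- The coefficient families of admissible kernels: `lam₀ = 1`, `lam_α ∈ [0,1]`, and `lam_α = 0`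
unless `|α| ≤ r` (only these coefficients occur in the kernel). -/
def thetaFeasible (n r d : ℕ) : Set ((Fin n → ℕ) → ℝ) :=
  {lam | lam 0 = 1 ∧ (∀ α, lam α ∈ Set.Icc (0 : ℝ) 1) ∧ (∀ α, α ∉ multiIndex n r → lam α = 0) ∧
    KernelCondition n r d (kernel n r lam)}

/-- `Θ^r_{n,d}`. -/
def Theta (n r d : ℕ) : ℝ := sInf (maxDev n d '' thetaFeasible n r d)

/-! ### The upper bound -/

/-- The polynomial `1 + ∑_{0 < |α| ≤ m} 2^{ω(α)} p_α T_α`. -/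
def boundPoly (n m : ℕ) (p : (Fin n → ℕ) → ℝ) : MvPolynomial (Fin n) ℝ :=
  1 + ∑ α ∈ (multiIndex n m).erase 0, MvPolynomial.C (2 ^ omega α * p α) * chebT α

/-- The coefficient families `p` with `p₀ = 1` such that
`1 + ∑_{0 < |α| ≤ m} 2^{ω(α)} p_α T_α ∈ 𝒯(1 ± x₁, …, 1 ± xₙ)_r`. -/
def boundFeasible (n r m : ℕ) : Set ((Fin n → ℕ) → ℝ) :=
  {p | p 0 = 1 ∧ boundPoly n m p ∈ cubePreordering n r}

/-- The infimum of `max_{|α| ≤ d} |1 - p_α|` over all `p` for which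
`1 + ∑_{0 < |α| ≤ m} 2^{ω(α)} p_α T_α ∈ 𝒯(1 ± x₁, …, 1 ± xₙ)_r`. -/
def thetaBound (n r d m : ℕ) : ℝ := sInf (maxDev n d '' boundFeasible n r m)

/-! ### The semidefinite program computing the upper bound -/

/-- The exponents `β` of the monomials in the Gram matrix that belongs to the product
`∏_{i ∈ I} gᵢ`: those with `2|β| + |I| ≤ r`. -/
def gramIndex (n r : ℕ) (I : Finset (Fin n ⊕ Fin n)) : Finset (Fin n → ℕ) :=
  (multiIndex n r).filter fun β => 2 * ∑ i, β i + I.card ≤ r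

/-- The polynomial `∑_{β,γ} Q_{βγ} x^β x^γ` of a matrix `Q` indexed by exponents. -/
def gramPoly {n : ℕ} {B : Finset (Fin n → ℕ)} (Q : Matrix B B ℝ) : MvPolynomial (Fin n) ℝ :=
  ∑ β : B, ∑ γ : B, MvPolynomial.C (Q β γ) *
    ((∏ i, MvPolynomial.X i ^ β.1 i) * ∏ i, MvPolynomial.X i ^ γ.1 i)

/-- The feasible objective values `t` of a semidefinite program with scalar variables `t`, `p_α`
and positive semidefinite matrix variables `Q_I`. Comparing the coefficients of the polynomial
identity gives linear equations in `p` and `Q`; the other constraints are linear inequalities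
in `t` and `p`. -/
def sdpValues (n r d m : ℕ) : Set ℝ :=
  {t | ∃ (p : (Fin n → ℕ) → ℝ)
      (Q : (I : Finset (Fin n ⊕ Fin n)) → Matrix (gramIndex n r I) (gramIndex n r I) ℝ),
    (∀ I, (Q I).PosSemidef) ∧
    boundPoly n m p = ∑ I, gramPoly (Q I) * ∏ i ∈ I, cubeGen n i ∧
    p 0 = 1 ∧ ∀ α ∈ multiIndex n d, -t ≤ 1 - p α ∧ 1 - p α ≤ t}

/-- The optimal value (infimum of the objective `t`) of the semidefinite program. -/
def sdpValue (n r d m : ℕ) : ℝ := sInf (sdpValues n r d m)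

/-! ### The infima are over nonempty sets of nonnegative numbers -/

theorem maxDev_nonneg (n d : ℕ) (c : (Fin n → ℕ) → ℝ) : 0 ≤ maxDev n d c :=
  (abs_nonneg _).trans
    (Finset.le_sup' (fun α => |1 - c α|) (zero_mem_multiIndex n d))

theorem sdpValues_nonneg {n r d m : ℕ} {t : ℝ} (ht : t ∈ sdpValues n r d m) : 0 ≤ t := by
  obtain ⟨p, Q, -, -, -, h⟩ := ht
  have := h 0 (zero_mem_multiIndex n d)
  linarith [this.1, this.2]

theorem C_mem_cubePreordering (n r : ℕ) {c : ℝ} (hc : 0 ≤ c) :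
    (MvPolynomial.C c : MvPolynomial (Fin n) ℝ) ∈ cubePreordering n r := by
  refine ⟨fun I => if I = ∅ then MvPolynomial.C c else 0, fun I => ?_, fun I => ?_, ?_⟩
  · dsimp only
    split_ifs
    · rw [← Real.mul_self_sqrt hc, MvPolynomial.C_mul]
      exact IsSumSq.mul_self _
    · exact IsSumSq.zero
  · dsimp only
    split_ifs with h
    · subst h
      simp
    · simp
  · rw [Finset.sum_eq_single ∅]
    · simp
    · intro I _ hI
      simp [hI]
    · simp

theorem boundFeasible_nonempty (n r m : ℕ) : (boundFeasible n r m).Nonempty := by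
  refine ⟨Pi.single 0 1, by simp, ?_⟩
  have : boundPoly n m (Pi.single 0 1) = MvPolynomial.C 1 := by
    rw [boundPoly, Finset.sum_eq_zero]
    · simp
    · intro α hα
      rw [Pi.single_eq_of_ne (Finset.ne_of_mem_erase hα)]
      simp
  rw [this]
  exact C_mem_cubePreordering n r zero_le_one

theorem thetaFeasible_nonempty (n r d : ℕ) : (thetaFeasible n r d).Nonempty := by
  refine ⟨Pi.single 0 1, by simp, fun α => ?_, fun α hα => ?_, fun f _ hf => ?_⟩
  · by_cases h : α = 0
    · subst h; simp
    · simp [Pi.single_eq_of_ne h]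
  · exact Pi.single_eq_of_ne (fun h => hα (by rw [h]; exact zero_mem_multiIndex n r)) _
  · have hK : ∀ x y, kernel n r (Pi.single 0 1) x y = 1 := by
      intro x y
      rw [kernel, Finset.sum_eq_zero]
      · simp
      · intro α hα
        rw [Pi.single_eq_of_ne (Finset.ne_of_mem_erase hα)]
        simp
    refine ⟨MvPolynomial.C (∫ y, MvPolynomial.eval y f ∂(chebMeasure n)),
      C_mem_cubePreordering n r (integral_nonneg_of_ae ?_), fun x => by simp [hK]⟩
    have hfin : IsFiniteMeasure Polynomial.Chebyshev.measureT := by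
      have := Polynomial.Chebyshev.integrable_measureT (f := fun _ => 1) continuousOn_const
      exact (integrable_const_iff_isFiniteMeasure one_ne_zero).mp this
    have hfin' : IsFiniteMeasure
        ((ENNReal.ofReal Real.pi)⁻¹ • Polynomial.Chebyshev.measureT) :=
      Measure.smul_finite _ (ENNReal.inv_ne_top.mpr (ENNReal.ofReal_pos.mpr Real.pi_pos).ne')
    have h1 : ∀ᵐ t ∂((ENNReal.ofReal Real.pi)⁻¹ • Polynomial.Chebyshev.measureT),
        t ∈ Set.Icc (-1 : ℝ) 1 := by
      refine Measure.ae_smul_measure ?_ _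
      rw [Polynomial.Chebyshev.measureT]
      filter_upwards [ae_restrict_mem measurableSet_Ioc] with t ht
      exact ⟨ht.1.le, ht.2⟩
    have h2 : ∀ᵐ y ∂(chebMeasure n), ∀ i, y i ∈ Set.Icc (-1 : ℝ) 1 :=
      ae_all_iff.mpr fun i => (Measure.tendsto_eval_ae_ae
        (μ := fun _ : Fin n => (ENNReal.ofReal Real.pi)⁻¹ • Polynomial.Chebyshev.measureT)
        (i := i)).eventually h1
    filter_upwards [h2] with y hy
    exact hf y ⟨fun i => (hy i).1, fun i => (hy i).2⟩

end ChebKernel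

end

/-! # Chebyshev kernels from truncated pre-orderings of the cube -/

/-! Write `P = ∑ 2^ω(α) p_α T_α` for a feasible polynomial. The substitution `x = cos θ` turns the
convolution on the cube into averages of rotations: since `cos k(θ+φ) + cos k(θ-φ) = 2 cos kθ cos
kφ`, averaging over the shifts `±φ` of the `i`-th angle multiplies `T_α` by `T_{α_i}(cos φ)`. The
crux is that such an average stays in `𝒯_r` without any loss of degree
(`exists_isRotationAverage_sq_mul_prod`). Doing this once per coordinate with `φ = arccos y_i` shows
that `x ↦ ∑ 2^ω(α) p_α T_α(y) T_α(x)` lies in `𝒯_r` for every `y` in the cube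
(`sum_eval_chebT_mul_chebT_mem`).

For `f ≥ 0` on the cube, the integral of `f(y)` against this kernel is, by Gauss quadrature, a
finite combination of such polynomials with nonnegative weights, hence lies in the convex cone
`𝒯_r`. By orthogonality only the coefficients with `|α| ≤ d` act on `f`, so the others may be cut
off.

It remains to have the coefficients in `[0,1]`. Testing `P ≥ 0` against `1 - T_α ≥ 0` gives `p_α ≤
1`. If the deviation is less than `1`, then `p_α > 0` for `|α| ≤ d`; otherwise the bound follows
from `Θ ≤ 1`, valid because every admissible coefficient lies in `[0,1]`.

The semidefinite program is the epigraph form of the same infimum with Gram matrices in place of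
sums of squares. Leading forms of real squares cannot cancel, so a degree bound on `σ_I` bounds
every square in it, which limits the size of `Q_I`. -/

noncomputable section

namespace ChebKernel
open MvPolynomial

/-! ### Degrees in sums of squares -/

section SumsOfSquares
variable {σ : Type*} {m : MonomialOrder σ}

/-- Two nonnegative leading coefficients at the same monomial can cancel only if both vanish, that
is, if both polynomials are zero. -/
theorem degree_le_degree_add_of_leadingCoeff_nonneg_of_le {p q : MvPolynomial σ ℝ}
    (hp : 0 ≤ m.leadingCoeff p) (hq : 0 ≤ m.leadingCoeff q)
    (h : m.toSyn (m.degree q) ≤ m.toSyn (m.degree p)) :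
    m.toSyn (m.degree p) ≤ m.toSyn (m.degree (p + q)) ∧ 0 ≤ m.leadingCoeff (p + q) := by
  rcases h.lt_or_eq with h | h
  · rw [m.degree_add_of_lt h, m.leadingCoeff_add_of_lt h]
    exact ⟨le_rfl, hp⟩
  · have hd : m.degree q = m.degree p := m.toSyn.injective h
    have hc : (p + q).coeff (m.degree p) = m.leadingCoeff p + m.leadingCoeff q := by
      rw [coeff_add, MonomialOrder.leadingCoeff, MonomialOrder.leadingCoeff, hd]
    by_cases h0 : m.leadingCoeff p + m.leadingCoeff q = 0
    · have hp0 : p = 0 := m.leadingCoeff_eq_zero_iff.mp (by linarith)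
      have hq0 : q = 0 := m.leadingCoeff_eq_zero_iff.mp (by linarith)
      simp [hp0, hq0]
    · have h1 : m.toSyn (m.degree p) ≤ m.toSyn (m.degree (p + q)) :=
        m.le_degree (by rw [mem_support_iff, hc]; exact h0)
      have h2 : m.toSyn (m.degree (p + q)) ≤ m.toSyn (m.degree p) := by
        refine m.degree_add_le.trans ?_
        rw [h, max_self]
      have h3 : m.degree (p + q) = m.degree p := m.toSyn.injective (le_antisymm h2 h1)
      refine ⟨h1, ?_⟩
      rw [MonomialOrder.leadingCoeff, h3, hc]
      exact add_nonneg hp hq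

theorem degree_le_degree_add_of_leadingCoeff_nonneg {p q : MvPolynomial σ ℝ}
    (hp : 0 ≤ m.leadingCoeff p) (hq : 0 ≤ m.leadingCoeff q) :
    m.toSyn (m.degree p) ≤ m.toSyn (m.degree (p + q)) ∧
      m.toSyn (m.degree q) ≤ m.toSyn (m.degree (p + q)) ∧ 0 ≤ m.leadingCoeff (p + q) := by
  rcases le_total (m.toSyn (m.degree q)) (m.toSyn (m.degree p)) with h | h
  · have := degree_le_degree_add_of_leadingCoeff_nonneg_of_le hp hq h
    exact ⟨this.1, h.trans this.1, this.2⟩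
  · have := degree_le_degree_add_of_leadingCoeff_nonneg_of_le hq hp h
    rw [add_comm q p] at this
    exact ⟨h.trans this.1, this.1, this.2⟩

theorem leadingCoeff_mul_self_nonneg (a : MvPolynomial σ ℝ) : 0 ≤ m.leadingCoeff (a * a) := by
  rw [m.leadingCoeff_mul]
  exact mul_self_nonneg _

theorem leadingCoeff_nonneg_of_isSumSq {s : MvPolynomial σ ℝ} (hs : IsSumSq s) :
    0 ≤ m.leadingCoeff s := by
  induction hs with
  | zero => simp
  | sq_add a _ ih =>
    exact (degree_le_degree_add_of_leadingCoeff_nonneg (leadingCoeff_mul_self_nonneg a) ih).2.2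

end SumsOfSquares

theorem totalDegree_mul_self {σ : Type*} (a : MvPolynomial σ ℝ) :
    (a * a).totalDegree = 2 * a.totalDegree := by
  rcases eq_or_ne a 0 with rfl | ha
  · simp
  · rw [totalDegree_mul_of_isDomain ha ha, two_mul]

variable {n r : ℕ}

/-- Leading forms cannot cancel in a sum of squares of real polynomials. -/
theorem totalDegree_le_of_sq_add {a s : MvPolynomial (Fin n) ℝ} (hs : IsSumSq s) :
    2 * a.totalDegree ≤ (a * a + s).totalDegree ∧ s.totalDegree ≤ (a * a + s).totalDegree := by
  have := degree_le_degree_add_of_leadingCoeff_nonneg (m := MonomialOrder.degLex)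
    (leadingCoeff_mul_self_nonneg a) (leadingCoeff_nonneg_of_isSumSq hs)
  rw [← totalDegree_mul_self]
  exact ⟨MvPolynomial.degLex_totalDegree_monotone this.1,
    MvPolynomial.degLex_totalDegree_monotone this.2.1⟩

/-! ### Generators of the cube and closure properties of the truncated pre-ordering -/

theorem cubeGen_totalDegree (j : Fin n ⊕ Fin n) : (cubeGen n j).totalDegree = 1 := by
  have h1 (c : ℝ) (hc : c ≠ 0) (i : Fin n) :
      (1 + C c * X i : MvPolynomial (Fin n) ℝ).totalDegree = 1 := by
    have hX : (C c * X i : MvPolynomial (Fin n) ℝ).totalDegree = 1 := by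
      rw [totalDegree_mul_of_isDomain (by simpa using hc) (X_ne_zero i), totalDegree_C,
        totalDegree_X]
    rw [add_comm, totalDegree_add_eq_left_of_totalDegree_lt, hX]
    rw [hX, totalDegree_one]
    exact one_pos
  rcases j with i | i
  · have := h1 (-1) (by norm_num) i
    simpa [cubeGen, sub_eq_add_neg] using this
  · have := h1 1 one_ne_zero i
    simpa [cubeGen] using this

theorem cubeGen_ne_zero (j : Fin n ⊕ Fin n) : cubeGen n j ≠ 0 := fun h => by
  have := cubeGen_totalDegree j
  simp [h] at this

theorem prod_cubeGen_ne_zero (I : Finset (Fin n ⊕ Fin n)) : ∏ j ∈ I, cubeGen n j ≠ 0 :=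
  Finset.prod_ne_zero_iff.mpr fun j _ => cubeGen_ne_zero j

theorem totalDegree_prod_cubeGen (I : Finset (Fin n ⊕ Fin n)) :
    (∏ j ∈ I, cubeGen n j).totalDegree = I.card := by
  classical
  induction I using Finset.induction_on with
  | empty => simp
  | insert j I hj ih =>
    rw [Finset.prod_insert hj, totalDegree_mul_of_isDomain (cubeGen_ne_zero j)
      (prod_cubeGen_ne_zero I), ih, cubeGen_totalDegree, Finset.card_insert_of_notMem hj, add_comm]

theorem totalDegree_mul_prod_cubeGen {s : MvPolynomial (Fin n) ℝ} (hs : s ≠ 0)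
    (I : Finset (Fin n ⊕ Fin n)) :
    (s * ∏ j ∈ I, cubeGen n j).totalDegree = s.totalDegree + I.card := by
  rw [totalDegree_mul_of_isDomain hs (prod_cubeGen_ne_zero I), totalDegree_prod_cubeGen]

theorem zero_mem_cubePreordering : (0 : MvPolynomial (Fin n) ℝ) ∈ cubePreordering n r :=
  ⟨fun _ => 0, fun _ => IsSumSq.zero, fun _ => by simp, by simp⟩

theorem add_mem_cubePreordering {p q : MvPolynomial (Fin n) ℝ} (hp : p ∈ cubePreordering n r)
    (hq : q ∈ cubePreordering n r) : p + q ∈ cubePreordering n r := by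
  obtain ⟨σ, h1, h2, rfl⟩ := hp
  obtain ⟨τ, k1, k2, rfl⟩ := hq
  refine ⟨fun I => σ I + τ I, fun I => (h1 I).add (k1 I), fun I => ?_, ?_⟩
  · rw [add_mul]
    exact (totalDegree_add _ _).trans (max_le (h2 I) (k2 I))
  · simp only [add_mul, Finset.sum_add_distrib]

theorem sum_mem_cubePreordering {ι : Type*} (s : Finset ι) {f : ι → MvPolynomial (Fin n) ℝ}
    (h : ∀ i ∈ s, f i ∈ cubePreordering n r) : ∑ i ∈ s, f i ∈ cubePreordering n r :=
  Finset.sum_induction f (· ∈ cubePreordering n r) (fun _ _ => add_mem_cubePreordering)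
    zero_mem_cubePreordering h

theorem C_mul_mem_cubePreordering {c : ℝ} (hc : 0 ≤ c) {p : MvPolynomial (Fin n) ℝ}
    (hp : p ∈ cubePreordering n r) : C c * p ∈ cubePreordering n r := by
  obtain ⟨σ, h1, h2, rfl⟩ := hp
  refine ⟨fun I => C c * σ I, fun I => ?_, fun I => ?_, ?_⟩
  · refine IsSumSq.mul ?_ (h1 I)
    rw [← Real.mul_self_sqrt hc, C_mul]
    exact IsSumSq.mul_self _
  · rw [mul_assoc]
    refine (totalDegree_mul _ _).trans ?_
    rw [totalDegree_C, zero_add]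
    exact h2 I
  · simp only [Finset.mul_sum, mul_assoc]

theorem sq_mul_prod_mem_cubePreordering {h : MvPolynomial (Fin n) ℝ} {I : Finset (Fin n ⊕ Fin n)}
    (hd : h = 0 ∨ 2 * h.totalDegree + I.card ≤ r) :
    h * h * ∏ j ∈ I, cubeGen n j ∈ cubePreordering n r := by
  classical
  rcases hd with rfl | hd
  · simpa using zero_mem_cubePreordering
  refine ⟨fun J => if J = I then h * h else 0, fun J => ?_, fun J => ?_, ?_⟩
  · dsimp only
    split_ifs
    · exact IsSumSq.mul_self _
    · exact IsSumSq.zero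
  · dsimp only
    split_ifs with hJ
    · subst hJ
      refine (totalDegree_mul _ _).trans ?_
      rwa [totalDegree_prod_cubeGen, totalDegree_mul_self]
    · simp
  · rw [Finset.sum_eq_single I] <;> simp +contextual

/-- Because squares do not cancel, the bound on the degree of `σ_I ∏ g_i` passes to each square in
`σ_I`. Additive properties of the pre-ordering therefore need checking only on single terms `h² ∏
g_i` that themselves obey the degree bound. -/
theorem cubePreordering_induction {P : MvPolynomial (Fin n) ℝ → Prop} (zero : P 0)
    (add : ∀ p q, P p → P q → P (p + q))
    (sq : ∀ h I, 2 * h.totalDegree + I.card ≤ r → P (h * h * ∏ j ∈ I, cubeGen n j))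
    {p : MvPolynomial (Fin n) ℝ} (hp : p ∈ cubePreordering n r) : P p := by
  obtain ⟨σ, h1, h2, rfl⟩ := hp
  refine Finset.sum_induction _ P add zero fun I _ => ?_
  have key : ∀ s : MvPolynomial (Fin n) ℝ, IsSumSq s → s.totalDegree + I.card ≤ r →
      P (s * ∏ j ∈ I, cubeGen n j) := by
    intro s hs
    induction hs with
    | zero => simpa using fun _ => zero
    | sq_add a hs ih =>
      intro hd
      have := totalDegree_le_of_sq_add (a := a) hs
      rw [add_mul]
      exact add _ _ (sq a I (by omega)) (ih (by omega))
  rcases eq_or_ne (σ I) 0 with h0 | h0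
  · simpa [h0] using zero
  · refine key _ (h1 I) ?_
    rw [← totalDegree_mul_prod_cubeGen h0]
    exact h2 I

theorem totalDegree_le_of_mem_cubePreordering {p : MvPolynomial (Fin n) ℝ}
    (hp : p ∈ cubePreordering n r) : p.totalDegree ≤ r := by
  obtain ⟨σ, -, h2, rfl⟩ := hp
  exact totalDegree_finsetSum_le fun I _ => h2 I

theorem eval_nonneg_of_mem_cubePreordering {p : MvPolynomial (Fin n) ℝ}
    (hp : p ∈ cubePreordering n r) {x : Fin n → ℝ} (hx : x ∈ Set.Icc (-1 : Fin n → ℝ) 1) :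
    0 ≤ eval x p := by
  refine cubePreordering_induction (P := fun p => 0 ≤ eval x p) (by simp)
    (fun p q h1 h2 => by rw [map_add]; exact add_nonneg h1 h2) (fun h I _ => ?_) hp
  rw [map_mul, map_mul, map_prod]
  refine mul_nonneg (mul_self_nonneg _) (Finset.prod_nonneg fun j _ => ?_)
  rcases j with i | i
  · have : x i ≤ 1 := hx.2 i
    simpa [cubeGen] using this
  · have : -1 ≤ x i := hx.1 i
    simp only [cubeGen, Sum.elim_inr, map_add, map_one, eval_X]
    linarith

end ChebKernel

/-! ### Gram matrices and the semidefinite program -/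

namespace ChebKernel
open MvPolynomial

variable {n r : ℕ}

theorem gramPoly_add {B : Finset (Fin n → ℕ)} (Q R : Matrix B B ℝ) :
    gramPoly (Q + R) = gramPoly Q + gramPoly R := by
  simp only [gramPoly, Matrix.add_apply, C_add, add_mul, Finset.sum_add_distrib]

theorem gramPoly_zero {B : Finset (Fin n → ℕ)} : gramPoly (0 : Matrix B B ℝ) = 0 := by
  simp [gramPoly]

theorem gramPoly_vecMulVec {B : Finset (Fin n → ℕ)} (v : B → ℝ) :
    gramPoly (Matrix.vecMulVec v v) =
      (∑ β : B, C (v β) * ∏ i, X i ^ β.1 i) * ∑ β : B, C (v β) * ∏ i, X i ^ β.1 i := by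
  rw [Finset.sum_mul_sum, gramPoly]
  refine Finset.sum_congr rfl fun β _ => Finset.sum_congr rfl fun γ _ => ?_
  rw [Matrix.vecMulVec_apply, C_mul]
  ring

theorem gramPoly_sum {ι : Type*} (s : Finset ι) {B : Finset (Fin n → ℕ)}
    (Q : ι → Matrix B B ℝ) : gramPoly (∑ k ∈ s, Q k) = ∑ k ∈ s, gramPoly (Q k) := by
  classical
  induction s using Finset.induction_on with
  | empty => simp [gramPoly_zero]
  | insert k s hk ih => rw [Finset.sum_insert hk, Finset.sum_insert hk, gramPoly_add, ih]

open scoped MatrixOrder in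
-- Factor `Q = AᵀA`; each row of `A` is the coefficient vector of one square.
theorem isSumSq_gramPoly {B : Finset (Fin n → ℕ)} {Q : Matrix B B ℝ} (hQ : Q.PosSemidef) :
    IsSumSq (gramPoly Q) := by
  obtain ⟨A, rfl⟩ := CStarAlgebra.nonneg_iff_eq_star_mul_self.mp hQ.nonneg
  have : star A * A = ∑ k, Matrix.vecMulVec (A k) (A k) := by
    ext β γ
    simp [Matrix.mul_apply, Matrix.sum_apply, Matrix.vecMulVec_apply, Matrix.star_apply]
  rw [this, gramPoly_sum]
  simp only [gramPoly_vecMulVec]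
  exact IsSumSq.sum_mul_self _ _

theorem monomial_eq_C_mul_prod (s : Fin n →₀ ℕ) (c : ℝ) :
    monomial s c = C c * ∏ i, X i ^ s i := by
  rw [monomial_eq, Finsupp.prod_fintype]
  simp

theorem eq_sum_C_mul_prod {B : Finset (Fin n → ℕ)} {h : MvPolynomial (Fin n) ℝ}
    (hB : ∀ β : Fin n → ℕ, ∑ i, β i ≤ h.totalDegree → β ∈ B) :
    h = ∑ β : B, C (h.coeff (Finsupp.equivFunOnFinite.symm β.1)) * ∏ i, X i ^ β.1 i := by
  have h1 := h.as_sum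
  rw [Finset.sum_coe_sort B
    fun β => C (h.coeff (Finsupp.equivFunOnFinite.symm β)) * ∏ i, X i ^ β i]
  have hsub : h.support ⊆ B.map Finsupp.equivFunOnFinite.symm.toEmbedding := by
    intro s hs
    rw [Finset.mem_map]
    refine ⟨s, hB s ?_, by ext; simp⟩
    have := le_totalDegree hs
    rwa [Finsupp.sum_fintype _ _ (by simp)] at this
  rw [Finset.sum_subset hsub (by simp +contextual), Finset.sum_map] at h1
  conv_lhs => rw [h1]
  refine Finset.sum_congr rfl fun β _ => ?_
  rw [monomial_eq_C_mul_prod]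
  simp

/-- Sums of squares have positive semidefinite Gram matrices. -/
theorem exists_posSemidef_gramPoly {B : Finset (Fin n → ℕ)} {D : ℕ}
    (hB : ∀ β : Fin n → ℕ, 2 * ∑ i, β i ≤ D → β ∈ B) {s : MvPolynomial (Fin n) ℝ}
    (hs : IsSumSq s) (hD : s.totalDegree ≤ D) :
    ∃ Q : Matrix B B ℝ, Q.PosSemidef ∧ gramPoly Q = s := by
  induction hs with
  | zero => exact ⟨0, Matrix.PosSemidef.zero, gramPoly_zero⟩
  | sq_add a hs ih =>
    have hd := totalDegree_le_of_sq_add (a := a) hs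
    obtain ⟨Q, hQ, rfl⟩ := ih (by omega)
    -- The Gram matrix of `a²` is the rank-one matrix of the coefficient vector of `a`.
    refine ⟨Matrix.vecMulVec (fun β => a.coeff (Finsupp.equivFunOnFinite.symm β.1))
      (fun β => a.coeff (Finsupp.equivFunOnFinite.symm β.1)) + Q, ?_, ?_⟩
    · exact (Matrix.posSemidef_vecMulVec_self_star _).add hQ
    · rw [gramPoly_add, gramPoly_vecMulVec, ← eq_sum_C_mul_prod]
      exact fun β hβ => hB β (by omega)

theorem mem_gramIndex {I : Finset (Fin n ⊕ Fin n)} {β : Fin n → ℕ} :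
    β ∈ gramIndex n r I ↔ 2 * ∑ i, β i + I.card ≤ r := by
  rw [gramIndex, Finset.mem_filter, mem_multiIndex]
  omega

theorem totalDegree_gramPoly_mul_le {I : Finset (Fin n ⊕ Fin n)}
    (Q : Matrix (gramIndex n r I) (gramIndex n r I) ℝ) :
    (gramPoly Q * ∏ j ∈ I, cubeGen n j).totalDegree ≤ r := by
  have hmon (β : Fin n → ℕ) : (∏ i, X i ^ β i : MvPolynomial (Fin n) ℝ).totalDegree ≤ ∑ i, β i :=
    (totalDegree_finsetProd _ _).trans (Finset.sum_le_sum fun i _ => by rw [totalDegree_X_pow])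
  rw [gramPoly, Finset.sum_mul]
  refine totalDegree_finsetSum_le fun β _ => ?_
  rw [Finset.sum_mul]
  refine totalDegree_finsetSum_le fun γ _ => ?_
  refine (totalDegree_mul _ _).trans ?_
  have h1 := totalDegree_mul (C (Q β γ))
    ((∏ i, X i ^ β.1 i) * ∏ i, X i ^ γ.1 i : MvPolynomial (Fin n) ℝ)
  have h2 := totalDegree_mul (∏ i, X i ^ β.1 i) (∏ i, X i ^ γ.1 i : MvPolynomial (Fin n) ℝ)
  have h3 := hmon β.1
  have h4 := hmon γ.1
  have h5 := mem_gramIndex.mp β.2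
  have h6 := mem_gramIndex.mp γ.2
  rw [totalDegree_C] at h1
  rw [totalDegree_prod_cubeGen]
  omega

theorem mem_cubePreordering_iff_exists_posSemidef {p : MvPolynomial (Fin n) ℝ} :
    p ∈ cubePreordering n r ↔
      ∃ Q : (I : Finset (Fin n ⊕ Fin n)) → Matrix (gramIndex n r I) (gramIndex n r I) ℝ,
        (∀ I, (Q I).PosSemidef) ∧ p = ∑ I, gramPoly (Q I) * ∏ i ∈ I, cubeGen n i := by
  constructor
  · rintro ⟨σ, h1, h2, rfl⟩
    have (I : Finset (Fin n ⊕ Fin n)) : ∃ Q : Matrix (gramIndex n r I) (gramIndex n r I) ℝ,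
        Q.PosSemidef ∧ gramPoly Q = σ I := by
      -- If `σ I = 0`, the set `I` may have more than `r` elements, and `r - I.card` would be
      -- truncated; if `σ I ≠ 0`, the degree bound forces `I.card ≤ r`.
      rcases eq_or_ne (σ I) 0 with h0 | h0
      · exact ⟨0, Matrix.PosSemidef.zero, by rw [gramPoly_zero, h0]⟩
      · have hd := h2 I
        have := totalDegree_mul_prod_cubeGen h0 I
        refine exists_posSemidef_gramPoly (D := r - I.card) (fun β hβ => ?_) (h1 I) ?_
        · rw [mem_gramIndex]
          omega
        · omega
    choose Q hQ hQσ using this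
    exact ⟨Q, hQ, by simp only [hQσ]⟩
  · rintro ⟨Q, hQ, rfl⟩
    exact ⟨fun I => gramPoly (Q I), fun I => isSumSq_gramPoly (hQ I),
      fun I => totalDegree_gramPoly_mul_le (Q I), rfl⟩

theorem maxDev_le_iff {n d : ℕ} {c : (Fin n → ℕ) → ℝ} {t : ℝ} :
    maxDev n d c ≤ t ↔ ∀ α ∈ multiIndex n d, |1 - c α| ≤ t := by
  rw [maxDev, Finset.sup'_le_iff]

theorem mem_sdpValues_iff {n r d m : ℕ} {t : ℝ} :
    t ∈ sdpValues n r d m ↔ ∃ p ∈ boundFeasible n r m, maxDev n d p ≤ t := by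
  simp only [sdpValues, boundFeasible, Set.mem_ofPred_eq, mem_cubePreordering_iff_exists_posSemidef,
    maxDev_le_iff, abs_le]
  constructor
  · rintro ⟨p, Q, h1, h2, h3, h4⟩
    exact ⟨p, ⟨h3, Q, h1, h2⟩, h4⟩
  · rintro ⟨p, ⟨h3, Q, h1, h2⟩, h4⟩
    exact ⟨p, Q, h1, h2, h3, h4⟩

theorem thetaBound_eq_sdpValue (n r d m : ℕ) : thetaBound n r d m = sdpValue n r d m := by
  obtain ⟨p₀, hp₀⟩ := boundFeasible_nonempty n r m
  apply le_antisymm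
  · refine le_csInf ⟨_, mem_sdpValues_iff.mpr ⟨p₀, hp₀, le_rfl⟩⟩ fun t ht => ?_
    obtain ⟨p, hp, hpt⟩ := mem_sdpValues_iff.mp ht
    have hbdd : BddBelow (maxDev n d '' boundFeasible n r m) :=
      ⟨0, by rintro _ ⟨q, -, rfl⟩; exact maxDev_nonneg n d q⟩
    exact (csInf_le hbdd ⟨p, hp, rfl⟩).trans hpt
  · refine le_csInf ⟨_, p₀, hp₀, rfl⟩ ?_
    rintro _ ⟨p, hp, rfl⟩
    have hbdd : BddBelow (sdpValues n r d m) := ⟨0, fun t ht => sdpValues_nonneg ht⟩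
    exact csInf_le hbdd (mem_sdpValues_iff.mpr ⟨p, hp, le_rfl⟩)

end ChebKernel

namespace ChebKernel
open MvPolynomial Real

variable {n r : ℕ}

/-! ### Averaging over the rotations by `±φ` in one angular variable -/

/-- The function `h(…, cos (θ + φ), …)`, with the shifted entry at position `i`, has the form
`a(cos θ) + sin θ * b(cos θ)` with polynomials `a` of degree at most `D` and `b` of degree less
than `D`. -/
def HasShift (i : Fin n) (φ : ℝ) (D : ℕ) (h : MvPolynomial (Fin n) ℝ) : Prop :=
  ∃ a b : MvPolynomial (Fin n) ℝ, a.totalDegree ≤ D ∧ (X i * b).totalDegree ≤ D ∧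
    ∀ (z : Fin n → ℝ) (θ : ℝ), eval (Function.update z i (cos (θ + φ))) h =
      eval (Function.update z i (cos θ)) a + sin θ * eval (Function.update z i (cos θ)) b

theorem totalDegree_le_totalDegree_X_mul (i : Fin n) (b : MvPolynomial (Fin n) ℝ) :
    b.totalDegree ≤ (X i * b).totalDegree := by
  rcases eq_or_ne b 0 with rfl | hb
  · simp
  · rw [totalDegree_mul_of_isDomain (X_ne_zero i) hb]
    exact Nat.le_add_left _ _

theorem totalDegree_C_mul_le (c : ℝ) (b : MvPolynomial (Fin n) ℝ) :
    (C c * b).totalDegree ≤ b.totalDegree :=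
  (totalDegree_mul _ _).trans (by rw [totalDegree_C, zero_add])

theorem totalDegree_X_mul_le (i : Fin n) (b : MvPolynomial (Fin n) ℝ) :
    (X i * b).totalDegree ≤ b.totalDegree + 1 :=
  (totalDegree_mul _ _).trans (by rw [totalDegree_X, add_comm])

theorem HasShift.mono {i : Fin n} {φ : ℝ} {D E : ℕ} {h : MvPolynomial (Fin n) ℝ}
    (hh : HasShift i φ D h) (hDE : D ≤ E) : HasShift i φ E h := by
  obtain ⟨a, b, ha, hb, hab⟩ := hh
  exact ⟨a, b, ha.trans hDE, hb.trans hDE, hab⟩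

theorem hasShift_C (i : Fin n) (φ : ℝ) (D : ℕ) (c : ℝ) : HasShift i φ D (C c) :=
  ⟨C c, 0, by simp, by simp, by simp⟩

theorem HasShift.add {i : Fin n} {φ : ℝ} {D : ℕ} {h k : MvPolynomial (Fin n) ℝ}
    (hh : HasShift i φ D h) (hk : HasShift i φ D k) : HasShift i φ D (h + k) := by
  obtain ⟨a, b, ha, hb, hab⟩ := hh
  obtain ⟨a', b', ha', hb', hab'⟩ := hk
  refine ⟨a + a', b + b', (totalDegree_add _ _).trans (max_le ha ha'), ?_, fun z θ => ?_⟩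
  · rw [mul_add]
    exact (totalDegree_add _ _).trans (max_le hb hb')
  · simp only [map_add, hab, hab']
    ring

theorem HasShift.X_mul {i : Fin n} {φ : ℝ} {D : ℕ} {h : MvPolynomial (Fin n) ℝ}
    (hh : HasShift i φ D h) (j : Fin n) : HasShift i φ (D + 1) (X j * h) := by
  obtain ⟨a, b, ha, hb, hab⟩ := hh
  rcases eq_or_ne j i with rfl | hji
  -- Expand `(x cos φ - sin θ sin φ)(a + sin θ b)` with `x = cos θ` and replace `sin² θ` by `1 -
  -- x²`.
  · refine ⟨C (cos φ) * (X j * a) + (C (-sin φ) * b + C (sin φ) * (X j * (X j * b))),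
      C (cos φ) * (X j * b) + C (-sin φ) * a, ?_, ?_, fun z θ => ?_⟩
    · refine (totalDegree_add _ _).trans (max_le ?_ ((totalDegree_add _ _).trans (max_le ?_ ?_)))
      · exact (totalDegree_C_mul_le _ _).trans ((totalDegree_X_mul_le _ _).trans (by omega))
      · exact (totalDegree_C_mul_le _ _).trans
          ((totalDegree_le_totalDegree_X_mul j b).trans (by omega))
      · exact (totalDegree_C_mul_le _ _).trans ((totalDegree_X_mul_le _ _).trans (by omega))
    · refine (totalDegree_X_mul_le _ _).trans (Nat.succ_le_succ ?_)
      refine (totalDegree_add _ _).trans (max_le ?_ ?_)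
      · exact (totalDegree_C_mul_le _ _).trans hb
      · exact (totalDegree_C_mul_le _ _).trans ha
    · simp only [map_mul, map_add, eval_X, eval_C, hab, Function.update_self]
      simp only [cos_add]
      linear_combination (-sin φ * eval (Function.update z j (cos θ)) b) * sin_sq_add_cos_sq θ
  · refine ⟨X j * a, X j * b, (totalDegree_X_mul_le _ _).trans (by omega), ?_, fun z θ => ?_⟩
    · rw [mul_left_comm]
      exact (totalDegree_X_mul_le _ _).trans (by omega)
    · simp only [map_mul, eval_X, hab, Function.update_of_ne hji]
      ring

theorem hasShift_monomial (i : Fin n) (φ : ℝ) (c : ℝ) (k : ℕ) :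
    ∀ s : Fin n →₀ ℕ, s.degree = k → HasShift i φ k (monomial s c) := by
  induction k with
  | zero =>
    intro s hs
    rw [Finsupp.degree_eq_zero_iff] at hs
    rw [hs]
    exact hasShift_C i φ 0 c
  | succ k ih =>
    intro s hs
    obtain ⟨j, hj⟩ : ∃ j, s j ≠ 0 := by
      by_contra! h
      have : s = 0 := by
        ext j
        simp [h j]
      rw [this] at hs
      simp at hs
    have hsj : s = Finsupp.single j 1 + (s - Finsupp.single j 1) := by
      rw [add_tsub_cancel_of_le]
      rw [Finsupp.single_le_iff]
      omega
    have hdeg : (s - Finsupp.single j 1).degree = k := by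
      have := congrArg Finsupp.degree hsj
      rw [map_add, Finsupp.degree_single] at this
      omega
    have : (monomial s c : MvPolynomial (Fin n) ℝ) =
        X j * monomial (s - Finsupp.single j 1) c := by
      rw [X, monomial_mul, one_mul, ← hsj]
    rw [this]
    exact (ih _ hdeg).X_mul j

theorem hasShift (i : Fin n) (φ : ℝ) (h : MvPolynomial (Fin n) ℝ) :
    HasShift i φ h.totalDegree h := by
  have key : ∀ S ⊆ h.support, HasShift i φ h.totalDegree (∑ s ∈ S, monomial s (h.coeff s)) := by
    intro S hS
    refine Finset.sum_induction _ (HasShift i φ h.totalDegree) (fun _ _ => HasShift.add) ?_ ?_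
    · simpa using hasShift_C i φ h.totalDegree 0
    · intro s hs
      exact (hasShift_monomial i φ _ _ s rfl).mono (le_totalDegree (hS hs))
  have := key h.support subset_rfl
  rwa [← h.as_sum] at this

/-- `q` is the average of `p` over the rotations by `φ` and `-φ` in the `i`-th angle. -/
def IsRotationAverage (i : Fin n) (φ : ℝ) (p q : MvPolynomial (Fin n) ℝ) : Prop :=
  ∀ (z : Fin n → ℝ) (θ : ℝ), eval (Function.update z i (cos θ)) q =
    (eval (Function.update z i (cos (θ + φ))) p + eval (Function.update z i (cos (θ - φ))) p) / 2

theorem IsRotationAverage.unique {i : Fin n} {φ : ℝ} {p q q' : MvPolynomial (Fin n) ℝ}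
    (h : IsRotationAverage i φ p q) (h' : IsRotationAverage i φ p q') : q = q' := by
  -- Every point of `[-1,1]` is a cosine, and a polynomial is determined by its values on a product
  -- of infinite sets.
  refine funext_set (fun _ => Set.Icc (-1 : ℝ) 1) (fun _ => Set.Icc_infinite (by norm_num)) ?_
  intro x hx
  have hi : cos (arccos (x i)) = x i :=
    cos_arccos (hx i (Set.mem_univ i)).1 (hx i (Set.mem_univ i)).2
  have h1 := (h x (arccos (x i))).trans (h' x (arccos (x i))).symm
  rwa [hi, Function.update_eq_self] at h1

theorem eval_update_prod_cubeGen {i : Fin n} {I : Finset (Fin n ⊕ Fin n)} (hl : Sum.inl i ∉ I)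
    (hr : Sum.inr i ∉ I) (z : Fin n → ℝ) (t : ℝ) :
    eval (Function.update z i t) (∏ j ∈ I, cubeGen n j) = eval z (∏ j ∈ I, cubeGen n j) := by
  rw [map_prod, map_prod]
  refine Finset.prod_congr rfl fun j hj => ?_
  rcases j with k | k
  · have : k ≠ i := by rintro rfl; exact hl hj
    simp [cubeGen, Function.update_of_ne this]
  · have : k ≠ i := by rintro rfl; exact hr hj
    simp [cubeGen, Function.update_of_ne this]

theorem eval_update_shift_neg {i : Fin n} {φ : ℝ} {h a b : MvPolynomial (Fin n) ℝ}
    (hab : ∀ (z : Fin n → ℝ) (θ : ℝ), eval (Function.update z i (cos (θ + φ))) h =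
      eval (Function.update z i (cos θ)) a + sin θ * eval (Function.update z i (cos θ)) b)
    (z : Fin n → ℝ) (θ : ℝ) : eval (Function.update z i (cos (θ - φ))) h =
      eval (Function.update z i (cos θ)) a - sin θ * eval (Function.update z i (cos θ)) b := by
  have := hab z (-θ)
  rw [← cos_neg, neg_add, neg_neg, ← sub_eq_add_neg, cos_neg, sin_neg] at this
  rw [this]
  ring

/-- Put `x = cos θ`. The two shifted values of `h` are `a ± sin θ b`. Generators not involving `x_i`
are unaffected. In each case the shifted factor in `x_i`, times `h²`, is the square of `u + v`,
where the reflection `θ ↦ -θ` preserves one summand up to sign change of the other. The cross term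
cancels in the average, leaving `u² + v²`. -/
theorem exists_isRotationAverage_sq_mul_prod (i : Fin n) (φ : ℝ) (h : MvPolynomial (Fin n) ℝ)
    (I : Finset (Fin n ⊕ Fin n)) (hd : 2 * h.totalDegree + I.card ≤ r) :
    ∃ q ∈ cubePreordering n r, IsRotationAverage i φ (h * h * ∏ j ∈ I, cubeGen n j) q := by
  classical
  obtain ⟨a, b, ha, hb, hab⟩ := hasShift i φ h
  have hab' := eval_update_shift_neg hab
  have hb1 := (totalDegree_le_totalDegree_X_mul i b).trans hb
  -- `J` collects the generators that do not involve the `i`-th variable; the four cases below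
  -- record which of `1 ± x_i` belong to `I`.
  set J := (I.erase (Sum.inl i)).erase (Sum.inr i) with hJ
  have hJl : Sum.inl i ∉ J := by simp [hJ]
  have hJr : Sum.inr i ∉ J := by simp [hJ]
  have hJr' : Sum.inr i ∉ insert (Sum.inl i) J := by simp [hJr]
  have hevJ := eval_update_prod_cubeGen hJl hJr
  have hIlr : Sum.inl i ∈ I → Sum.inr i ∈ I → I = insert (Sum.inr i) (insert (Sum.inl i) J) := by
    intro h1 h2
    ext x
    simp only [hJ, Finset.mem_insert, Finset.mem_erase]
    grind
  have hIl : Sum.inl i ∈ I → Sum.inr i ∉ I → I = insert (Sum.inl i) J := by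
    intro h1 h2
    ext x
    simp only [hJ, Finset.mem_insert, Finset.mem_erase]
    grind
  have hIr : Sum.inl i ∉ I → Sum.inr i ∈ I → I = insert (Sum.inr i) J := by
    intro h1 h2
    ext x
    simp only [hJ, Finset.mem_insert, Finset.mem_erase]
    grind
  have hI : Sum.inl i ∉ I → Sum.inr i ∉ I → I = J := by
    intro h1 h2
    ext x
    simp only [hJ, Finset.mem_erase]
    grind
  have hcl : (insert (Sum.inl i) J).card = J.card + 1 := Finset.card_insert_of_notMem hJl
  have hcr : (insert (Sum.inr i) J).card = J.card + 1 := Finset.card_insert_of_notMem hJr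
  have hclr : (insert (Sum.inr i) (insert (Sum.inl i) J)).card = J.card + 2 := by
    rw [Finset.card_insert_of_notMem hJr', hcl]
  have hpl : ∏ j ∈ insert (Sum.inl i) J, cubeGen n j = (1 - X i) * ∏ j ∈ J, cubeGen n j := by
    rw [Finset.prod_insert hJl]
    rfl
  have hpr : ∏ j ∈ insert (Sum.inr i) J, cubeGen n j = (1 + X i) * ∏ j ∈ J, cubeGen n j := by
    rw [Finset.prod_insert hJr]
    rfl
  have hplr : ∏ j ∈ insert (Sum.inr i) (insert (Sum.inl i) J), cubeGen n j =
      (1 + X i) * ((1 - X i) * ∏ j ∈ J, cubeGen n j) := by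
    rw [Finset.prod_insert hJr', hpl]
    rfl
  have hC : cos (φ / 2) ^ 2 + sin (φ / 2) ^ 2 = 1 := cos_sq_add_sin_sq _
  have hc : cos φ = cos (φ / 2) ^ 2 - sin (φ / 2) ^ 2 := by
    rw [← cos_two_mul', mul_div_cancel₀ φ two_ne_zero]
  have hs : sin φ = 2 * sin (φ / 2) * cos (φ / 2) := by
    rw [← sin_two_mul, mul_div_cancel₀ φ two_ne_zero]
  have hφ : sin φ ^ 2 + cos φ ^ 2 = 1 := sin_sq_add_cos_sq φ
  have hXa : (X i * a).totalDegree ≤ h.totalDegree + 1 :=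
    (totalDegree_X_mul_le i a).trans (by omega)
  have hXXb : (X i * (X i * b)).totalDegree ≤ h.totalDegree + 1 :=
    (totalDegree_X_mul_le i _).trans (by omega)
  have hdeg {p q : MvPolynomial (Fin n) ℝ} {D : ℕ} (hp : p.totalDegree ≤ D)
      (hq : q.totalDegree ≤ D) (c c' : ℝ) : (C c * p + C c' * q).totalDegree ≤ D :=
    (totalDegree_add _ _).trans (max_le ((totalDegree_C_mul_le _ _).trans hp)
      ((totalDegree_C_mul_le _ _).trans hq))
  have mem {u : MvPolynomial (Fin n) ℝ} {D : ℕ} {K : Finset (Fin n ⊕ Fin n)}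
      (hu : u.totalDegree ≤ D) (hK : 2 * D + K.card ≤ r) :
      u * u * ∏ j ∈ K, cubeGen n j ∈ cubePreordering n r :=
    sq_mul_prod_mem_cubePreordering (Or.inr (by omega))
  by_cases h1 : Sum.inl i ∈ I <;> by_cases h2 : Sum.inr i ∈ I
  -- Here `(1 + x_i)(1 - x_i)` becomes `sin²(θ+φ)`, and `sin(θ+φ)(a + sin θ b) = A + sin θ B`; the
  -- average is `A² + (1 - x²)B²`. `A` may have degree one more than `h`, which is paid for by
  -- dropping both generators.
  · rw [hIlr h1 h2] at hd ⊢
    have hA : (C (sin φ) * (X i * a) + C (cos φ) * (C 1 * b + C (-1) * (X i * (X i * b)))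
        ).totalDegree ≤ h.totalDegree + 1 := hdeg hXa (hdeg (by omega) hXXb _ _) _ _
    have hB : (C (cos φ) * a + C (sin φ) * (X i * b)).totalDegree ≤ h.totalDegree :=
      hdeg ha hb _ _
    refine ⟨_, add_mem_cubePreordering (mem (K := J) hA (by omega))
      (mem (K := insert (Sum.inr i) (insert (Sum.inl i) J)) hB (by omega)), fun z θ => ?_⟩
    simp only [hplr, map_add, map_sub, map_mul, map_one, map_neg, eval_X, eval_C, hab, hab',
      Function.update_self, hevJ]
    simp only [cos_add, cos_sub]
    generalize eval (Function.update z i (cos θ)) a = a'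
    generalize eval (Function.update z i (cos θ)) b = b'
    generalize eval z (∏ j ∈ J, cubeGen n j) = g
    have hσ : sin θ ^ 2 + cos θ ^ 2 = 1 := sin_sq_add_cos_sq θ
    generalize sin θ = σ at *
    generalize cos θ = x at *
    generalize sin φ = s at *
    generalize cos φ = c at *
    have e1 (σ : ℝ) (hσ : σ ^ 2 + x ^ 2 = 1) :
        (1 + (x * c - σ * s)) * (1 - (x * c - σ * s)) * (a' + σ * b') ^ 2 =
        ((s * x * a' + c * (1 - x ^ 2) * b') + σ * (c * a' + s * x * b')) ^ 2 := by
      have e2 : (1 + (x * c - σ * s)) * (1 - (x * c - σ * s)) = (σ * c + x * s) ^ 2 := by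
        linear_combination -hφ - (s ^ 2 + c ^ 2) * hσ
      have e3 : (s * x * a' + c * (1 - x ^ 2) * b') + σ * (c * a' + s * x * b') =
          (σ * c + x * s) * (a' + σ * b') := by
        linear_combination (-c * b') * hσ
      rw [e2, e3]
      ring
    have e4 := e1 σ hσ
    -- Changing the sign of `sin θ` yields the factor for the shift by `-φ`.
    have e5 := e1 (-σ) (by rw [neg_sq]; exact hσ)
    linear_combination (-g / 2) * e4 + (-g / 2) * e5 - (g * (c * a' + s * x * b') ^ 2) * hσ
  -- Half angles give `√(1 - cos(θ+φ)) = ±(√(1-x) cos(φ/2) + √(1+x) sin(φ/2))` for `θ ∈ [0,π]`.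
  -- Multiplying by `a + √(1-x)√(1+x) b` and collecting the terms in `√(1-x)` and `√(1+x)` gives the
  -- two squares below.
  · rw [hIl h1 h2] at hd ⊢
    have hA : (C (cos (φ / 2)) * a + C (sin (φ / 2)) * (C 1 * b + C 1 * (X i * b))).totalDegree ≤
        h.totalDegree := hdeg ha (hdeg hb1 hb _ _) _ _
    have hB : (C (sin (φ / 2)) * a + C (cos (φ / 2)) * (C 1 * b + C (-1) * (X i * b))
        ).totalDegree ≤ h.totalDegree := hdeg ha (hdeg hb1 hb _ _) _ _
    refine ⟨_, add_mem_cubePreordering (mem (K := insert (Sum.inl i) J) hA (by omega))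
      (mem (K := insert (Sum.inr i) J) hB (by omega)), fun z θ => ?_⟩
    simp only [hpl, hpr, map_add, map_sub, map_mul, map_one, map_neg, eval_X, eval_C, hab, hab',
      Function.update_self, hevJ]
    simp only [cos_add, cos_sub]
    generalize eval (Function.update z i (cos θ)) a = a'
    generalize eval (Function.update z i (cos θ)) b = b'
    generalize eval z (∏ j ∈ J, cubeGen n j) = g
    have hσ : sin θ ^ 2 + cos θ ^ 2 = 1 := sin_sq_add_cos_sq θ
    rw [hc, hs]
    linear_combination (-g * (b' ^ 2 * (1 - cos θ * (cos (φ / 2) ^ 2 - sin (φ / 2) ^ 2)) +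
      2 * (2 * sin (φ / 2) * cos (φ / 2)) * a' * b')) * hσ +
      (g * (a' ^ 2 + (1 - cos θ ^ 2) * b' ^ 2)) * hC
  -- The same with `√(1 + cos(θ+φ)) = ±(√(1+x) cos(φ/2) - √(1-x) sin(φ/2))`.
  · rw [hIr h1 h2] at hd ⊢
    have hA : (C (cos (φ / 2)) * a + C (sin (φ / 2)) * (C (-1) * b + C 1 * (X i * b))
        ).totalDegree ≤ h.totalDegree := hdeg ha (hdeg hb1 hb _ _) _ _
    have hB : (C (-sin (φ / 2)) * a + C (cos (φ / 2)) * (C 1 * b + C 1 * (X i * b))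
        ).totalDegree ≤ h.totalDegree := hdeg ha (hdeg hb1 hb _ _) _ _
    refine ⟨_, add_mem_cubePreordering (mem (K := insert (Sum.inr i) J) hA (by omega))
      (mem (K := insert (Sum.inl i) J) hB (by omega)), fun z θ => ?_⟩
    simp only [hpl, hpr, map_add, map_sub, map_mul, map_one, map_neg, eval_X, eval_C, hab, hab',
      Function.update_self, hevJ]
    simp only [cos_add, cos_sub]
    generalize eval (Function.update z i (cos θ)) a = a'
    generalize eval (Function.update z i (cos θ)) b = b'
    generalize eval z (∏ j ∈ J, cubeGen n j) = g
    have hσ : sin θ ^ 2 + cos θ ^ 2 = 1 := sin_sq_add_cos_sq θ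
    rw [hc, hs]
    linear_combination (-g * (b' ^ 2 * (1 + cos θ * (cos (φ / 2) ^ 2 - sin (φ / 2) ^ 2)) -
      2 * (2 * sin (φ / 2) * cos (φ / 2)) * a' * b')) * hσ +
      (g * (a' ^ 2 + (1 - cos θ ^ 2) * b' ^ 2)) * hC
  -- The average of `h²` is `a² + (1 - x²)b²`; the two new generators are paid for by `b` having
  -- degree less than that of `h`, unless `b = 0`.
  · rw [hI h1 h2] at hd ⊢
    refine ⟨_, add_mem_cubePreordering (mem (K := J) ha (by omega))
      (sq_mul_prod_mem_cubePreordering (h := b)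
        (I := insert (Sum.inr i) (insert (Sum.inl i) J)) ?_), fun z θ => ?_⟩
    · rcases eq_or_ne b 0 with h0 | h0
      · exact Or.inl h0
      · rw [totalDegree_mul_of_isDomain (X_ne_zero i) h0, totalDegree_X] at hb
        exact Or.inr (by omega)
    · simp only [hplr, map_add, map_sub, map_mul, map_one, eval_X, hab, hab',
        Function.update_self, hevJ]
      linear_combination (-(eval (Function.update z i (cos θ)) b) ^ 2 *
        eval z (∏ j ∈ J, cubeGen n j)) * sin_sq_add_cos_sq θ

theorem exists_isRotationAverage (i : Fin n) (φ : ℝ) {p : MvPolynomial (Fin n) ℝ}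
    (hp : p ∈ cubePreordering n r) : ∃ q ∈ cubePreordering n r, IsRotationAverage i φ p q := by
  refine cubePreordering_induction
    (P := fun p => ∃ q ∈ cubePreordering n r, IsRotationAverage i φ p q)
    ⟨0, zero_mem_cubePreordering, fun z θ => by simp⟩ ?_
    (exists_isRotationAverage_sq_mul_prod i φ) hp
  rintro p p' ⟨q, hq, hpq⟩ ⟨q', hq', hpq'⟩
  refine ⟨q + q', add_mem_cubePreordering hq hq', fun z θ => ?_⟩
  rw [map_add, map_add, map_add, hpq, hpq']
  ring

/-! ### Rotation averages of Chebyshev expansions -/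

theorem eval_chebT (α : Fin n → ℕ) (x : Fin n → ℝ) :
    eval x (chebT α) = ∏ i, (Polynomial.Chebyshev.T ℝ (α i : ℤ)).eval (x i) := by
  rw [chebT, map_prod]
  refine Finset.prod_congr rfl fun i _ => ?_
  have : (MvPolynomial.aeval x) (Polynomial.aeval (X i : MvPolynomial (Fin n) ℝ)
      (Polynomial.Chebyshev.T ℝ (α i : ℤ))) =
      Polynomial.aeval (x i) (Polynomial.Chebyshev.T ℝ (α i : ℤ)) := by
    rw [← Polynomial.aeval_algHom_apply, MvPolynomial.aeval_X]
  rwa [Polynomial.coe_aeval_eq_eval, MvPolynomial.aeval_eq_eval] at this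

theorem eval_update_chebT (α : Fin n → ℕ) (z : Fin n → ℝ) (i : Fin n) (t : ℝ) :
    eval (Function.update z i t) (chebT α) = (Polynomial.Chebyshev.T ℝ (α i : ℤ)).eval t *
      ∏ j ∈ Finset.univ.erase i, (Polynomial.Chebyshev.T ℝ (α j : ℤ)).eval (z j) := by
  rw [eval_chebT, ← Finset.mul_prod_erase _ _ (Finset.mem_univ i), Function.update_self]
  congr 1
  refine Finset.prod_congr rfl fun j hj => ?_
  rw [Function.update_of_ne (Finset.ne_of_mem_erase hj)]

theorem isRotationAverage_sum_chebT (i : Fin n) (φ : ℝ) (A : Finset (Fin n → ℕ))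
    (c : (Fin n → ℕ) → ℝ) :
    IsRotationAverage i φ (∑ α ∈ A, C (c α) * chebT α)
      (∑ α ∈ A, C (c α * (Polynomial.Chebyshev.T ℝ (α i : ℤ)).eval (cos φ)) * chebT α) := by
  intro z θ
  simp only [map_sum, map_mul, eval_C, ← Finset.sum_add_distrib, Finset.sum_div]
  refine Finset.sum_congr rfl fun α _ => ?_
  simp only [eval_update_chebT, Polynomial.Chebyshev.T_real_cos, mul_add, mul_sub]
  simp only [cos_add, cos_sub]
  ring

/-- Convolution with a point of the cube preserves the truncated pre-ordering. -/
theorem sum_eval_chebT_mul_chebT_mem {A : Finset (Fin n → ℕ)} {c : (Fin n → ℕ) → ℝ}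
    (h : ∑ α ∈ A, C (c α) * chebT α ∈ cubePreordering n r) {y : Fin n → ℝ}
    (hy : y ∈ Set.Icc (-1 : Fin n → ℝ) 1) :
    ∑ α ∈ A, C (c α * eval y (chebT α)) * chebT α ∈ cubePreordering n r := by
  classical
  -- Rotate one coordinate at a time, with `φ = arccos (y i)`.
  have key : ∀ S : Finset (Fin n), ∑ α ∈ A,
      C (c α * ∏ i ∈ S, (Polynomial.Chebyshev.T ℝ (α i : ℤ)).eval (y i)) * chebT α ∈
        cubePreordering n r := by
    intro S
    induction S using Finset.induction_on with
    | empty => simpa using h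
    | insert i S hi ih =>
      obtain ⟨q, hq, hqa⟩ := exists_isRotationAverage i (arccos (y i)) ih
      have := hqa.unique (isRotationAverage_sum_chebT i (arccos (y i)) A _)
      rw [cos_arccos (hy.1 i) (hy.2 i)] at this
      rw [this] at hq
      convert hq using 4 with α
      rw [Finset.prod_insert hi]
      ring_nf
  have := key Finset.univ
  simpa only [eval_chebT] using this

end ChebKernel

/-! ### Quadrature, orthogonality and coefficients of feasible families -/

namespace ChebKernel
open MvPolynomial Real
open Polynomial.Chebyshev hiding C

variable {n r : ℕ}

instance isFiniteMeasure_measureT : IsFiniteMeasure measureT :=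
  (integrable_const_iff_isFiniteMeasure (one_ne_zero (α := ℝ))).mp
    (integrable_measureT (f := fun _ => 1) continuousOn_const)

instance isFiniteMeasure_smul_measureT :
    IsFiniteMeasure ((ENNReal.ofReal π)⁻¹ • measureT) :=
  Measure.smul_finite _ (ENNReal.inv_ne_top.mpr (ENNReal.ofReal_pos.mpr pi_pos).ne')

theorem integral_prod_chebMeasure (f : Fin n → ℝ → ℝ) :
    ∫ y, ∏ i, f i (y i) ∂(chebMeasure n) = ∏ i, (π⁻¹ * ∫ x, f i x ∂measureT) := by
  rw [chebMeasure, integral_fintype_prod_eq_prod]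
  refine Finset.prod_congr rfl fun i _ => ?_
  rw [integral_smul_measure, ENNReal.toReal_inv, ENNReal.toReal_ofReal pi_pos.le, smul_eq_mul]

theorem eval_monomial_eq_prod (s : Fin n →₀ ℕ) (c : ℝ) (y : Fin n → ℝ) :
    eval y (monomial s c) = c * ∏ i, y i ^ s i := by
  rw [eval_monomial, Finsupp.prod_fintype _ _ (by simp)]

theorem integrable_eval (f : MvPolynomial (Fin n) ℝ) :
    Integrable (fun y => eval y f) (chebMeasure n) := by
  induction f using MvPolynomial.induction_on' with
  | monomial s c =>
    simp only [eval_monomial_eq_prod]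
    refine Integrable.const_mul ?_ c
    refine Integrable.fintype_prod (f := fun i x => x ^ s i) fun i => ?_
    exact (integrable_measureT (by fun_prop)).smul_measure
      (ENNReal.inv_ne_top.mpr (ENNReal.ofReal_pos.mpr pi_pos).ne')
  | add p q hp hq =>
    simp only [map_add]
    exact hp.add hq

/-- The product Chebyshev–Gauss quadrature rule. -/
theorem exists_quadrature (n D : ℕ) : ∃ (ι : Type) (_ : Fintype ι) (w : ℝ) (z : ι → Fin n → ℝ),
    0 ≤ w ∧ (∀ j, z j ∈ Set.Icc (-1 : Fin n → ℝ) 1) ∧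
    ∀ q : MvPolynomial (Fin n) ℝ, q.totalDegree ≤ D →
      ∫ y, eval y q ∂(chebMeasure n) = ∑ j, w * eval (z j) q := by
  -- The zeros of `T_{D+1}`. The rule with these nodes is exact up to degree `2D + 1` in each
  -- variable, more than the `D` needed, and all its weights are equal.
  let t : Fin (D + 1) → ℝ := fun j => cos ((2 * (j : ℕ) + 1) / (2 * (D + 1 : ℕ)) * π)
  refine ⟨Fin n → Fin (D + 1), inferInstance, ∏ _i : Fin n, ((D + 1 : ℕ) : ℝ)⁻¹,
    fun j i => t (j i), by positivity,
    fun j => ⟨fun i => neg_one_le_cos _, fun i => cos_le_one _⟩, fun q hq => ?_⟩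
  have hpow (k : ℕ) (hk : k ≤ D) :
      π⁻¹ * ∫ x, x ^ k ∂measureT = ∑ j, ((D + 1 : ℕ) : ℝ)⁻¹ * t j ^ k := by
    have h := integral_eq_sumZeroes (n := D + 1) (P := Polynomial.X ^ k) (Nat.succ_ne_zero D) (by
      rw [Polynomial.degree_X_pow]
      norm_cast
      omega)
    simp only [Polynomial.eval_pow, Polynomial.eval_X] at h
    rw [h, sumZeroes, Finset.sum_range, ← Finset.mul_sum, ← mul_assoc]
    simp only [Polynomial.eval_pow, Polynomial.eval_X, t]
    congr 1
    field_simp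
  have hmon (s : Fin n →₀ ℕ) (c : ℝ) (hs : ∀ i, s i ≤ D) :
      ∫ y, eval y (monomial s c) ∂(chebMeasure n) = ∑ j : Fin n → Fin (D + 1),
        (∏ _i : Fin n, ((D + 1 : ℕ) : ℝ)⁻¹) * eval (fun i => t (j i)) (monomial s c) := by
    simp only [eval_monomial_eq_prod, integral_const_mul]
    rw [integral_prod_chebMeasure fun i x => x ^ s i,
      Finset.prod_congr rfl fun i _ => hpow (s i) (hs i), Finset.prod_univ_sum,
      Fintype.piFinset_univ, Finset.mul_sum]
    refine Finset.sum_congr rfl fun j _ => ?_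
    rw [Finset.prod_mul_distrib]
    ring
  rw [q.as_sum]
  simp only [map_sum]
  rw [integral_finsetSum _ fun s _ => integrable_eval _]
  simp only [Finset.mul_sum]
  rw [Finset.sum_comm]
  refine Finset.sum_congr rfl fun s hs => hmon s _ fun i => ?_
  refine le_trans ?_ hq
  refine le_trans ?_ (le_totalDegree hs)
  rw [Finsupp.sum_fintype _ _ (by simp)]
  exact Finset.single_le_sum (f := s) (fun _ _ => Nat.zero_le _) (Finset.mem_univ i)

theorem integral_eval_nonneg {q : MvPolynomial (Fin n) ℝ}
    (hq : ∀ x ∈ Set.Icc (-1 : Fin n → ℝ) 1, 0 ≤ eval x q) :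
    0 ≤ ∫ y, eval y q ∂(chebMeasure n) := by
  obtain ⟨ι, _, w, z, hw, hz, h⟩ := exists_quadrature n q.totalDegree
  rw [h q le_rfl]
  exact Finset.sum_nonneg fun j _ => mul_nonneg hw (hq _ (hz j))

/-- Trade a factor `x` for `x T_{b+1} = (T_{b+2} + T_b)/2`; both new indices still exceed the
remaining exponent. -/
theorem integral_pow_mul_T_eq_zero (k : ℕ) :
    ∀ a : ℕ, k < a → ∫ x, x ^ k * (T ℝ (a : ℤ)).eval x ∂measureT = 0 := by
  induction k with
  | zero =>
    intro a ha
    simpa using integral_eval_T_real_measureT_of_ne_zero (n := a) (by omega)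
  | succ k ih =>
    intro a ha
    obtain ⟨b, rfl⟩ : ∃ b, a = b + 1 := ⟨a - 1, by omega⟩
    have hrec (x : ℝ) : x ^ (k + 1) * (T ℝ ((b + 1 : ℕ) : ℤ)).eval x =
        2⁻¹ * (x ^ k * (T ℝ ((b + 2 : ℕ) : ℤ)).eval x) +
          2⁻¹ * (x ^ k * (T ℝ ((b : ℕ) : ℤ)).eval x) := by
      have := congrArg (Polynomial.eval x) (T_add_two ℝ (b : ℤ))
      simp only [Polynomial.eval_sub, Polynomial.eval_mul, Polynomial.eval_X,
        Polynomial.eval_ofNat] at this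
      push_cast
      rw [this]
      ring
    simp only [hrec]
    rw [integral_add (integrable_measureT (by fun_prop)) (integrable_measureT (by fun_prop)),
      integral_const_mul, integral_const_mul, ih _ (by omega), ih _ (by omega)]
    simp

/-- Each monomial of `f` has some exponent below the corresponding `α i`, so that one-dimensional
factor of the integral vanishes. -/
theorem integral_mul_chebT_eq_zero {f : MvPolynomial (Fin n) ℝ} {α : Fin n → ℕ}
    (h : f.totalDegree < ∑ i, α i) :
    ∫ y, eval y (f * chebT α) ∂(chebMeasure n) = 0 := by
  rw [f.as_sum, Finset.sum_mul]
  simp only [map_sum]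
  rw [integral_finsetSum _ fun s _ => integrable_eval _]
  refine Finset.sum_eq_zero fun s hs => ?_
  obtain ⟨i, hi⟩ : ∃ i, s i < α i := by
    by_contra! hle
    have h1 := le_totalDegree hs
    rw [Finsupp.sum_fintype _ _ (by simp)] at h1
    exact absurd ((Finset.sum_le_sum fun i _ => hle i).trans h1) (not_le.mpr h)
  simp only [map_mul, eval_monomial_eq_prod, eval_chebT, mul_assoc, ← Finset.prod_mul_distrib]
  rw [integral_const_mul, integral_prod_chebMeasure fun i x => x ^ s i * (T ℝ (α i : ℤ)).eval x,
    Finset.prod_eq_zero (Finset.mem_univ i), mul_zero]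
  rw [integral_pow_mul_T_eq_zero _ _ hi, mul_zero]

theorem integral_chebT_mul_chebT (α β : Fin n → ℕ) :
    ∫ y, eval y (chebT α * chebT β) ∂(chebMeasure n) = if α = β then (2 ^ omega α)⁻¹ else 0 := by
  simp only [map_mul, eval_chebT, ← Finset.prod_mul_distrib]
  rw [integral_prod_chebMeasure fun i x => (T ℝ (α i : ℤ)).eval x * (T ℝ (β i : ℤ)).eval x]
  split_ifs with h
  · subst h
    have (i : Fin n) : π⁻¹ * ∫ x, (T ℝ (α i : ℤ)).eval x * (T ℝ (α i : ℤ)).eval x ∂measureT =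
        if α i ≠ 0 then (2 : ℝ)⁻¹ else 1 := by
      split_ifs with h0
      · rw [integral_T_real_mul_self_measureT_of_ne_zero h0]
        field_simp
      · rw [not_not.mp h0, Nat.cast_zero, integral_eval_T_real_mul_self_measureT_zero,
          inv_mul_cancel₀ pi_ne_zero]
    simp only [this]
    rw [← Finset.prod_filter, Finset.prod_const, omega, inv_pow]
  · obtain ⟨i, hi⟩ := Function.ne_iff.mp h
    rw [Finset.prod_eq_zero (Finset.mem_univ i)]
    rw [integral_eval_T_real_mul_eval_T_real_measureT_of_ne hi, mul_zero]

theorem chebT_zero : chebT (0 : Fin n → ℕ) = 1 := by simp [chebT]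

theorem omega_zero : omega (0 : Fin n → ℕ) = 0 := by simp [omega]

theorem boundPoly_eq_sum {m : ℕ} {p : (Fin n → ℕ) → ℝ} (hp : p 0 = 1) :
    boundPoly n m p = ∑ α ∈ multiIndex n m, C (2 ^ omega α * p α) * chebT α := by
  rw [← Finset.add_sum_erase _ _ (zero_mem_multiIndex n m), boundPoly, chebT_zero, omega_zero, hp]
  simp

theorem integral_boundPoly_mul_chebT {m : ℕ} {p : (Fin n → ℕ) → ℝ} (hp : p 0 = 1)
    {β : Fin n → ℕ} (hβ : β ∈ multiIndex n m) :
    ∫ y, eval y (boundPoly n m p * chebT β) ∂(chebMeasure n) = p β := by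
  rw [boundPoly_eq_sum hp, Finset.sum_mul]
  simp only [map_sum]
  rw [integral_finsetSum _ fun s _ => integrable_eval _, Finset.sum_eq_single β]
  · simp only [mul_assoc (C _), map_mul (eval _) (C _), eval_C]
    rw [integral_const_mul, integral_chebT_mul_chebT, if_pos rfl]
    field_simp
  · intro α _ hα
    simp only [mul_assoc (C _), map_mul (eval _) (C _), eval_C]
    rw [integral_const_mul, integral_chebT_mul_chebT, if_neg hα, mul_zero]
  · exact fun h => absurd hβ h

theorem abs_eval_chebT_le_one (α : Fin n → ℕ) {x : Fin n → ℝ}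
    (hx : x ∈ Set.Icc (-1 : Fin n → ℝ) 1) : |eval x (chebT α)| ≤ 1 := by
  rw [eval_chebT, Finset.abs_prod]
  refine Finset.prod_le_one (fun i _ => abs_nonneg _) fun i _ => ?_
  rw [← cos_arccos (hx.1 i) (hx.2 i), T_real_cos]
  exact abs_cos_le_one _

/-- The coefficients of a feasible family are at most one. -/
theorem le_one_of_mem_boundFeasible {m : ℕ} {p : (Fin n → ℕ) → ℝ} (hp : p ∈ boundFeasible n r m)
    {α : Fin n → ℕ} (hα : α ∈ multiIndex n m) : p α ≤ 1 := by
  have h : 0 ≤ ∫ y, eval y (boundPoly n m p * chebT 0 - boundPoly n m p * chebT α)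
      ∂(chebMeasure n) := by
    refine integral_eval_nonneg fun x hx => ?_
    rw [← mul_sub, map_mul, map_sub, chebT_zero, map_one]
    exact mul_nonneg (eval_nonneg_of_mem_cubePreordering hp.2 hx)
      (sub_nonneg.mpr (abs_le.mp (abs_eval_chebT_le_one α hx)).2)
  simp only [map_sub] at h
  rw [integral_sub (integrable_eval _) (integrable_eval _),
    integral_boundPoly_mul_chebT hp.1 (zero_mem_multiIndex n m),
    integral_boundPoly_mul_chebT hp.1 hα, hp.1] at h
  linarith

/-- When `m > r`, membership in `𝒯_r` bounds the degree of the polynomial by `r` and so kills its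
higher Chebyshev coefficients. -/
theorem eq_zero_of_mem_boundFeasible {m : ℕ} {p : (Fin n → ℕ) → ℝ} (hp : p ∈ boundFeasible n r m)
    {α : Fin n → ℕ} (hα : α ∈ multiIndex n m) (hr : α ∉ multiIndex n r) : p α = 0 := by
  rw [← integral_boundPoly_mul_chebT hp.1 hα]
  apply integral_mul_chebT_eq_zero
  rw [mem_multiIndex] at hr
  exact (totalDegree_le_of_mem_cubePreordering hp.2).trans_lt (not_le.mp hr)

end ChebKernel

/-! ### The convolution kernel and the bound on `Θ` -/

namespace ChebKernel
open MvPolynomial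

variable {n r : ℕ}

theorem chebHat1_eval (k : ℕ) (x : ℝ) : (chebHat1 k).eval x =
    (if k ≠ 0 then √2 else 1) * (Polynomial.Chebyshev.T ℝ (k : ℤ)).eval x := by
  rw [chebHat1]
  by_cases h : k = 0
  · subst h
    simp
  · simp [h]

theorem chebHat_mul_chebHat (α : Fin n → ℕ) (x y : Fin n → ℝ) :
    chebHat α x * chebHat α y = 2 ^ omega α * (eval x (chebT α) * eval y (chebT α)) := by
  have h2 : ∏ i, (if α i ≠ 0 then √2 else 1) = √2 ^ omega α := by
    rw [← Finset.prod_filter, Finset.prod_const, omega]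
  simp only [chebHat, chebHat1_eval, Finset.prod_mul_distrib, h2, eval_chebT]
  rw [mul_mul_mul_comm, ← mul_pow, Real.mul_self_sqrt zero_le_two]

theorem kernel_eq_sum {lam : (Fin n → ℕ) → ℝ} (h0 : lam 0 = 1) (x y : Fin n → ℝ) :
    kernel n r lam x y = ∑ α ∈ multiIndex n r,
      lam α * 2 ^ omega α * (eval x (chebT α) * eval y (chebT α)) := by
  rw [← Finset.add_sum_erase _ _ (zero_mem_multiIndex n r), kernel, h0, chebT_zero, omega_zero]
  simp only [mul_assoc, chebHat_mul_chebHat]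
  simp

theorem integral_mul_kernel {lam : (Fin n → ℕ) → ℝ} (h0 : lam 0 = 1)
    (f : MvPolynomial (Fin n) ℝ) (x : Fin n → ℝ) :
    ∫ y, eval y f * kernel n r lam x y ∂(chebMeasure n) = ∑ α ∈ multiIndex n r,
      lam α * 2 ^ omega α * eval x (chebT α) * ∫ y, eval y (f * chebT α) ∂(chebMeasure n) := by
  have h (y : Fin n → ℝ) : eval y f * kernel n r lam x y = ∑ α ∈ multiIndex n r,
      lam α * 2 ^ omega α * eval x (chebT α) * eval y (f * chebT α) := by
    rw [kernel_eq_sum h0, Finset.mul_sum]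
    refine Finset.sum_congr rfl fun α _ => ?_
    rw [map_mul]
    ring
  simp only [h]
  rw [integral_finsetSum _ fun α _ => (integrable_eval _).const_mul _]
  simp only [integral_const_mul]

theorem totalDegree_chebT_le (α : Fin n → ℕ) : (chebT α).totalDegree ≤ ∑ i, α i := by
  refine (totalDegree_finsetProd _ _).trans (Finset.sum_le_sum fun i _ => ?_)
  rw [Polynomial.aeval_eq_sum_range]
  refine totalDegree_finsetSum_le fun j hj => ?_
  refine (totalDegree_smul_le _ _).trans ?_
  rw [totalDegree_X_pow]
  have : (Polynomial.Chebyshev.T ℝ (α i : ℤ)).natDegree = α i := by simp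
  rw [Finset.mem_range, this] at hj
  omega

/-- The kernel whose coefficients are those of a feasible family, cut off above degree `d`,
satisfies the kernel condition: the coefficients above degree `d` do not act on polynomials of
degree at most `d`. -/
theorem kernelCondition_of_mem_boundFeasible {d m : ℕ} (hm : d ≤ m) {p lam : (Fin n → ℕ) → ℝ}
    (hp : p ∈ boundFeasible n r m) (hlam : ∀ α ∈ multiIndex n d, lam α = p α) :
    KernelCondition n r d (kernel n r lam) := by
  intro f hf hf0
  -- The integrands are `f * chebT α` with `|α| ≤ m`, hence of degree at most `d + m`.
  obtain ⟨ι, _, w, z, hw, hz, hquad⟩ := exists_quadrature n (d + m)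
  have hmem (j : ι) := sum_eval_chebT_mul_chebT_mem (by
    rw [← boundPoly_eq_sum hp.1]; exact hp.2) (hz j)
  refine ⟨∑ j, C (w * eval (z j) f) * ∑ α ∈ multiIndex n m,
    C (2 ^ omega α * p α * eval (z j) (chebT α)) * chebT α, sum_mem_cubePreordering _ fun j _ =>
      C_mul_mem_cubePreordering (mul_nonneg hw (hf0 _ (hz j))) (hmem j), fun x => ?_⟩
  have hlam0 : lam 0 = 1 := (hlam 0 (zero_mem_multiIndex n d)).trans hp.1
  have hzero {α : Fin n → ℕ} (hα : α ∉ multiIndex n d) :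
      ∫ y, eval y (f * chebT α) ∂(chebMeasure n) = 0 := by
    rw [mem_multiIndex] at hα
    exact integral_mul_chebT_eq_zero (by omega)
  rw [integral_mul_kernel hlam0]
  trans ∑ α ∈ multiIndex n m,
    p α * 2 ^ omega α * eval x (chebT α) * ∫ y, eval y (f * chebT α) ∂(chebMeasure n)
  · simp only [map_sum, map_mul, eval_C, Finset.mul_sum]
    rw [Finset.sum_comm]
    refine Finset.sum_congr rfl fun α hα => ?_
    simp only [← map_mul]
    rw [hquad _ ((totalDegree_mul _ _).trans (add_le_add hf ((totalDegree_chebT_le α).trans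
      (mem_multiIndex.mp hα)))), Finset.mul_sum]
    refine Finset.sum_congr rfl fun j _ => ?_
    rw [map_mul]
    ring
  -- Both sums reduce to the common indices: terms with `|α| > d` vanish by orthogonality to `f`,
  -- those with `|α| > r` because `p α = 0`.
  · trans ∑ α ∈ multiIndex n d ∩ multiIndex n r,
      lam α * 2 ^ omega α * eval x (chebT α) * ∫ y, eval y (f * chebT α) ∂(chebMeasure n)
    · symm
      rw [Finset.sum_congr rfl fun α hα => by rw [hlam α (Finset.mem_inter.mp hα).1]]
      refine Finset.sum_subset (fun α hα => ?_) fun α hα hα' => ?_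
      · have := mem_multiIndex.mp (Finset.mem_inter.mp hα).1
        exact mem_multiIndex.mpr (by omega)
      · rw [Finset.mem_inter, not_and_or] at hα'
        rcases hα' with h | h
        · rw [hzero h, mul_zero]
        · rw [eq_zero_of_mem_boundFeasible hp hα h]
          simp
    · refine Finset.sum_subset Finset.inter_subset_right fun α hα hα' => ?_
      rw [hzero fun h => hα' (Finset.mem_inter.mpr ⟨h, hα⟩), mul_zero]

theorem Theta_le_maxDev {d : ℕ} {lam : (Fin n → ℕ) → ℝ} (h : lam ∈ thetaFeasible n r d) :
    Theta n r d ≤ maxDev n d lam := by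
  have hbdd : BddBelow (maxDev n d '' thetaFeasible n r d) :=
    ⟨0, by rintro _ ⟨q, -, rfl⟩; exact maxDev_nonneg n d q⟩
  exact csInf_le hbdd ⟨lam, h, rfl⟩

theorem Theta_le_one (n r d : ℕ) : Theta n r d ≤ 1 := by
  obtain ⟨lam, h⟩ := thetaFeasible_nonempty n r d
  refine (Theta_le_maxDev h).trans (maxDev_le_iff.mpr fun α _ => ?_)
  have := h.2.1 α
  rw [abs_le]
  constructor <;> linarith [this.1, this.2]

theorem Theta_le_maxDev_of_mem_boundFeasible {d m : ℕ} (hm : d ≤ m) {p : (Fin n → ℕ) → ℝ}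
    (hp : p ∈ boundFeasible n r m) : Theta n r d ≤ maxDev n d p := by
  classical
  -- A deviation below `1` makes `p α` positive for `|α| ≤ d`, as admissibility requires.
  by_cases h1 : 1 ≤ maxDev n d p
  · exact (Theta_le_one n r d).trans h1
  have hmd {α : Fin n → ℕ} (hα : α ∈ multiIndex n d) : α ∈ multiIndex n m :=
    mem_multiIndex.mpr ((mem_multiIndex.mp hα).trans hm)
  -- Above degree `d` the `p α` may be negative, so they are replaced by `0`; neither the kernel
  -- condition nor `maxDev n d` is affected.
  let lam : (Fin n → ℕ) → ℝ := fun α => if α ∈ multiIndex n d then p α else 0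
  have hlam : ∀ α ∈ multiIndex n d, lam α = p α := fun α hα => if_pos hα
  have hlam' : ∀ α ∉ multiIndex n d, lam α = 0 := fun α hα => if_neg hα
  have hmem : lam ∈ thetaFeasible n r d := by
    refine ⟨(hlam 0 (zero_mem_multiIndex n d)).trans hp.1, fun α => ?_, fun α hα => ?_,
      kernelCondition_of_mem_boundFeasible hm hp hlam⟩
    · by_cases hα : α ∈ multiIndex n d
      · rw [hlam α hα]
        refine ⟨?_, le_one_of_mem_boundFeasible hp (hmd hα)⟩
        have := (abs_le.mp (maxDev_le_iff.mp (le_refl (maxDev n d p)) α hα)).2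
        linarith
      · rw [hlam' α hα]
        exact ⟨le_rfl, zero_le_one⟩
    · by_cases hαd : α ∈ multiIndex n d
      · rw [hlam α hαd]
        exact eq_zero_of_mem_boundFeasible hp (hmd hαd) hα
      · exact hlam' α hαd
  refine (Theta_le_maxDev hmem).trans (maxDev_le_iff.mpr fun α hα => ?_)
  rw [hlam α hα]
  exact maxDev_le_iff.mp le_rfl α hα

theorem Theta_le_thetaBound (n r : ℕ) {d m : ℕ} (hm : d ≤ m) :
    Theta n r d ≤ thetaBound n r d m := by
  refine le_csInf ((boundFeasible_nonempty n r m).image _) ?_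
  rintro _ ⟨p, hp, rfl⟩
  exact Theta_le_maxDev_of_mem_boundFeasible hm hp

end ChebKernel

end

theorem theorem6 (n r d m : ℕ) (hm : d ≤ m) :
    ChebKernel.Theta n r d ≤ ChebKernel.thetaBound n r d m ∧
      ChebKernel.thetaBound n r d m = ChebKernel.sdpValue n r d m :=
  ⟨ChebKernel.Theta_le_thetaBound n r hm, ChebKernel.thetaBound_eq_sdpValue n r d m⟩
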